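/- All logarithms are to base $2$. Let $d\ge 1$, and call a positive semidefinite $d\times d$ complex matrix of trace $1$ a state on $\mathbb{C}^d$. For states $\rho,\sigma$ let $S(\rho|\sigma)=\operatorname{Tr}\rho\log\rho-\operatorname{Tr}\rho\log\sigma$ if the support of $\rho$ is contained in the support of $\sigma$, and $S(\rho|\sigma)=+\infty$ otherwise. Let $\mathcal{D}$ be a convex set of states on $\mathbb{C}^d$ (not necessarily compact or closed) that contains the maximally mixed state $I/d$, and let $E_R^{\mathcal{D}}(\rho)=\inf_{\sigma\in\mathcal{D}}S(\rho|\sigma)$. Let $H(x)=-x\log x-(1-x)\log(1-x)$ for $0\le x\le 1$, with $0\log 0=0$, and $\|A\|_1=\operatorname{Tr}\sqrt{AA^\dagger}$. Then $E_R^{\mathcal{D}}(\rho)$ is finite for every state $\rho$, and: (1) (robustness under admixtures) for all states $\rho,\sigma$ on $\mathbb{C}^d$ and all $\varepsilon\in[0,1]$, $$\bigl|E_R^{\mathcal{D}}((1-\varepsilon)\rho+\varepsilon\sigma)-E_R^{\mathcal{D}}(\rho)\bigr|\le 2\varepsilon\log d+H(\varepsilon);$$ (2) (asymptotic continuity) for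 all states $\rho,\sigma$ on $\mathbb{C}^d$ such that $\varepsilon=\|\rho-\sigma\|_1$ satisfies $\varepsilon\le 1$, $$\bigl|E_R^{\mathcal{D}}(\rho)-E_R^{\mathcal{D}}(\sigma)\bigr|\le 4\varepsilon\log d+2H(\varepsilon).$$ -/

import Mathlib

open scoped Matrix ComplexOrder

noncomputable section

namespace RelEntDist

/-- The set of states on `ℂ^d`: positive semidefinite complex matrices of trace one. -/
def states (d : ℕ) : Set (Matrix (Fin d) (Fin d) ℂ) :=
  {ρ | ρ.PosSemidef ∧ ρ.trace = 1}

/-- The maximally mixed state `I / d`. -/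
def maxMixed (d : ℕ) : Matrix (Fin d) (Fin d) ℂ := ((d : ℂ)⁻¹) • 1

/-- The trace norm `‖A‖₁ = Tr √(A A†)`, the square root being taken by functional calculus. -/
def traceNorm {d : ℕ} (A : Matrix (Fin d) (Fin d) ℂ) : ℝ :=
  (cfc Real.sqrt (A * Aᴴ)).trace.re

/-- The base-2 logarithm of a positive semidefinite matrix by functional calculus. As
`Real.logb 2 0 = 0`, it is the logarithm on the support and `0` on the kernel. -/
def mlog {d : ℕ} (A : Matrix (Fin d) (Fin d) ℂ) : Matrix (Fin d) (Fin d) ℂ :=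
  cfc (Real.logb 2) A

open Classical in
/-- The quantum relative entropy `S(ρ|σ) = Tr ρ log ρ - Tr ρ log σ` in bits, with value `+∞` unless
the support of `ρ` is contained in the support of `σ`, i.e. unless `ker σ ⊆ ker ρ`. -/
def relEntropy {d : ℕ} (ρ σ : Matrix (Fin d) (Fin d) ℂ) : EReal :=
  if ∀ v : Fin d → ℂ, σ *ᵥ v = 0 → ρ *ᵥ v = 0 then
    (((ρ * mlog ρ).trace.re - (ρ * mlog σ).trace.re : ℝ) : EReal)
  else ⊤

/-- The relative entropy distance `E_R^D(ρ) = inf_{σ ∈ D} S(ρ|σ)`, an extended real number. -/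
def relEntDist {d : ℕ} (D : Set (Matrix (Fin d) (Fin d) ℂ)) (ρ : Matrix (Fin d) (Fin d) ℂ) :
    EReal :=
  ⨅ σ ∈ D, relEntropy ρ σ

/-- The binary entropy in bits, meant for `0 ≤ x ≤ 1` (with `0 log 0 = 0`). -/
def binEntropyBits (x : ℝ) : ℝ :=
  -x * Real.logb 2 x - (1 - x) * Real.logb 2 (1 - x)

end RelEntDist

end

noncomputable section

namespace RelEntDist

open Finset

/-! Write S(ρ|ω) as the cross entropy -Tr ρ log ω minus the entropy S(ρ); the cross entropy is
affine in ρ. Let τ = (1-ε)ρ + εσ.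

For an upper bound on E(τ), replace a competitor ω for ρ by (1-ε)ω + ε I/d, which stays in the
convex set and has full support. It commutes with ω, so its cross entropies are estimated eigenvalue
by eigenvalue; with concavity of entropy this gives E(τ) ≤ (1-ε)E(ρ) + ε log d + H(ε). Conversely,
any competitor for τ with finite relative entropy also serves ρ, and `entropy_mix_le` gives
(1-ε)E(ρ) ≤ E(τ) + ε log d + H(ε). Since |E| ≤ log d, both combine to the robustness bound.

For asymptotic continuity, the Jordan decomposition of ρ - σ produces a state that is an admixture,
with one weight x, to both ρ and σ. Robustness is applied twice, and x is then traded for the trace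
norm using concavity of 2x + H(x). -/

variable {d : ℕ} {A B C ρ σ τ ω : Matrix (Fin d) (Fin d) ℂ} {D : Set (Matrix (Fin d) (Fin d) ℂ)}
  {ε : ℝ}

/-! ### Eigenbases and the change of basis between them. -/

/-- The functional calculus of a Hermitian matrix in its eigenbasis. -/
theorem cfc_eq_mul_diagonal_mul (hA : A.IsHermitian) (f : ℝ → ℝ) :
    cfc f A = (hA.eigenvectorUnitary : Matrix (Fin d) (Fin d) ℂ) *
      Matrix.diagonal (fun i => (f (hA.eigenvalues i) : ℂ)) *
      (hA.eigenvectorUnitary : Matrix (Fin d) (Fin d) ℂ)ᴴ := by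
  rw [hA.cfc_eq, Matrix.IsHermitian.cfc, Unitary.conjStarAlgAut_apply]
  rfl

theorem eq_mul_diagonal_mul (hA : A.IsHermitian) :
    A = (hA.eigenvectorUnitary : Matrix (Fin d) (Fin d) ℂ) *
      Matrix.diagonal (fun i => (hA.eigenvalues i : ℂ)) *
      (hA.eigenvectorUnitary : Matrix (Fin d) (Fin d) ℂ)ᴴ := by
  conv_lhs => rw [hA.spectral_theorem, Unitary.conjStarAlgAut_apply]
  rfl

theorem conjTranspose_mul_eigenvectorUnitary (hA : A.IsHermitian) :
    (hA.eigenvectorUnitary : Matrix (Fin d) (Fin d) ℂ)ᴴ *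
      (hA.eigenvectorUnitary : Matrix (Fin d) (Fin d) ℂ) = 1 :=
  Unitary.coe_star_mul_self hA.eigenvectorUnitary

theorem eigenvectorUnitary_mul_conjTranspose (hA : A.IsHermitian) :
    (hA.eigenvectorUnitary : Matrix (Fin d) (Fin d) ℂ) *
      (hA.eigenvectorUnitary : Matrix (Fin d) (Fin d) ℂ)ᴴ = 1 :=
  Unitary.coe_mul_star_self hA.eigenvectorUnitary

/-- The diagonal entries of `B` in the eigenbasis of `A`. -/
def diagIn (hA : A.IsHermitian) (B : Matrix (Fin d) (Fin d) ℂ) (i : Fin d) : ℝ :=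
  (((hA.eigenvectorUnitary : Matrix (Fin d) (Fin d) ℂ)ᴴ * B * hA.eigenvectorUnitary) i i).re

/-- The matrix of change of basis between the eigenbases of two Hermitian matrices. -/
def transition (hA : A.IsHermitian) (hB : B.IsHermitian) : Matrix (Fin d) (Fin d) ℂ :=
  (hA.eigenvectorUnitary : Matrix (Fin d) (Fin d) ℂ)ᴴ * hB.eigenvectorUnitary

theorem trace_mul_cfc (hA : A.IsHermitian) (B : Matrix (Fin d) (Fin d) ℂ) (f : ℝ → ℝ) :
    (B * cfc f A).trace.re = ∑ i, f (hA.eigenvalues i) * diagIn hA B i := by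
  rw [cfc_eq_mul_diagonal_mul hA, ← mul_assoc, Matrix.trace_mul_comm, ← mul_assoc, ← mul_assoc,
    Matrix.trace, Complex.re_sum]
  refine sum_congr rfl fun i _ => ?_
  rw [Matrix.diag_apply, Matrix.mul_diagonal, diagIn, Complex.re_mul_ofReal, mul_comm]

theorem diagIn_mix (hA : A.IsHermitian) (a b : ℝ) (i : Fin d) :
    diagIn hA (a • B + b • C) i = a * diagIn hA B i + b * diagIn hA C i := by
  simp [diagIn, mul_add, add_mul]

theorem sum_diagIn (hA : A.IsHermitian) (B : Matrix (Fin d) (Fin d) ℂ) :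
    ∑ i, diagIn hA B i = B.trace.re := by
  have : B.trace = ((hA.eigenvectorUnitary : Matrix (Fin d) (Fin d) ℂ)ᴴ * B *
      hA.eigenvectorUnitary).trace := by
    rw [Matrix.trace_mul_comm, ← mul_assoc, eigenvectorUnitary_mul_conjTranspose, one_mul]
  rw [this, Matrix.trace, Complex.re_sum]
  rfl

theorem diagIn_nonneg (hA : A.IsHermitian) (hB : B.PosSemidef) (i : Fin d) :
    0 ≤ diagIn hA B i :=
  (Complex.le_def.1 ((hB.conjTranspose_mul_mul_same _).diag_nonneg (i := i))).1

theorem conj_self_eq_diagonal (hA : A.IsHermitian) :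
    (hA.eigenvectorUnitary : Matrix (Fin d) (Fin d) ℂ)ᴴ * A * hA.eigenvectorUnitary =
      Matrix.diagonal (fun i => (hA.eigenvalues i : ℂ)) := by
  refine (congrArg (fun M => (hA.eigenvectorUnitary : Matrix (Fin d) (Fin d) ℂ)ᴴ * M *
    hA.eigenvectorUnitary) (eq_mul_diagonal_mul hA)).trans ?_
  rw [mul_assoc, mul_assoc, conjTranspose_mul_eigenvectorUnitary, mul_one, ← mul_assoc,
    conjTranspose_mul_eigenvectorUnitary, one_mul]

theorem diagIn_self (hA : A.IsHermitian) (i : Fin d) : diagIn hA A i = hA.eigenvalues i := by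
  rw [diagIn, conj_self_eq_diagonal hA]
  simp

theorem conj_eq_transition (hA : A.IsHermitian) (hB : B.IsHermitian) :
    (hA.eigenvectorUnitary : Matrix (Fin d) (Fin d) ℂ)ᴴ * B * hA.eigenvectorUnitary =
      transition hA hB * Matrix.diagonal (fun i => (hB.eigenvalues i : ℂ)) *
        (transition hA hB)ᴴ := by
  conv_lhs =>
    enter [1, 2]
    rw [eq_mul_diagonal_mul hB]
  simp only [transition, Matrix.conjTranspose_mul, Matrix.conjTranspose_conjTranspose, mul_assoc]

theorem diagIn_eq_sum (hA : A.IsHermitian) (hB : B.IsHermitian) (i : Fin d) :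
    diagIn hA B i = ∑ j, hB.eigenvalues j * ‖transition hA hB i j‖ ^ 2 := by
  rw [diagIn, conj_eq_transition hA hB, Matrix.mul_apply, Complex.re_sum]
  refine sum_congr rfl fun j _ => ?_
  rw [Matrix.mul_diagonal, Matrix.conjTranspose_apply, mul_right_comm, Complex.star_def,
    Complex.mul_conj, ← Complex.ofReal_mul, Complex.ofReal_re, Complex.normSq_eq_norm_sq, mul_comm]

theorem sum_norm_sq_transition_right (hA : A.IsHermitian) (hB : B.IsHermitian) (i : Fin d) :
    ∑ j, ‖transition hA hB i j‖ ^ 2 = 1 := by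
  have h : transition hA hB * (transition hA hB)ᴴ = 1 := by
    rw [transition, Matrix.conjTranspose_mul, Matrix.conjTranspose_conjTranspose, mul_assoc,
      ← mul_assoc (hB.eigenvectorUnitary : Matrix (Fin d) (Fin d) ℂ),
      eigenvectorUnitary_mul_conjTranspose, one_mul, conjTranspose_mul_eigenvectorUnitary]
  have := congrArg Complex.re (congrFun (congrFun h i) i)
  rw [Matrix.mul_apply, Complex.re_sum, Matrix.one_apply_eq, Complex.one_re] at this
  rw [← this]
  refine sum_congr rfl fun j _ => ?_
  rw [Matrix.conjTranspose_apply, Complex.star_def, Complex.mul_conj, Complex.ofReal_re,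
    Complex.normSq_eq_norm_sq]

theorem sum_norm_sq_transition_left (hA : A.IsHermitian) (hB : B.IsHermitian) (j : Fin d) :
    ∑ i, ‖transition hA hB i j‖ ^ 2 = 1 := by
  rw [← sum_norm_sq_transition_right hB hA j]
  refine sum_congr rfl fun i _ => ?_
  have : transition hB hA = (transition hA hB)ᴴ := by simp [transition]
  rw [this, Matrix.conjTranspose_apply, norm_star]

/-! ### Entropy and cross entropy. -/

/-- The von Neumann entropy in bits. -/
def entropy (ρ : Matrix (Fin d) (Fin d) ℂ) : ℝ := -(ρ * mlog ρ).trace.re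

/-- The cross entropy `-Tr ρ log σ` in bits. -/
def crossEntropy (ρ σ : Matrix (Fin d) (Fin d) ℂ) : ℝ := -(ρ * mlog σ).trace.re

theorem crossEntropy_mix (a b : ℝ) :
    crossEntropy (a • ρ + b • σ) ω = a * crossEntropy ρ ω + b * crossEntropy σ ω := by
  simp [crossEntropy, add_mul, Matrix.trace_add, Matrix.trace_smul]
  ring

theorem crossEntropy_eq_sum (hσ : σ.IsHermitian) :
    crossEntropy ρ σ = -∑ i, Real.logb 2 (hσ.eigenvalues i) * diagIn hσ ρ i := by
  rw [crossEntropy, mlog, trace_mul_cfc hσ]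

theorem entropy_eq_sum (hρ : ρ.IsHermitian) :
    entropy ρ = (∑ i, Real.negMulLog (hρ.eigenvalues i)) / Real.log 2 := by
  rw [show entropy ρ = crossEntropy ρ ρ from rfl, crossEntropy_eq_sum hρ, sum_div, ← sum_neg_distrib]
  refine sum_congr rfl fun i _ => ?_
  rw [diagIn_self, Real.negMulLog, Real.logb]
  ring

theorem sum_eigenvalues (hρ : ρ ∈ states d) : ∑ i, hρ.1.1.eigenvalues i = 1 := by
  have := sum_diagIn hρ.1.1 ρ
  simpa [diagIn_self, hρ.2] using this

theorem eigenvalues_le_one (hρ : ρ ∈ states d) (i : Fin d) : hρ.1.1.eigenvalues i ≤ 1 := by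
  rw [← sum_eigenvalues hρ]
  exact single_le_sum (fun j _ => hρ.1.eigenvalues_nonneg j) (mem_univ i)

theorem entropy_nonneg (hρ : ρ ∈ states d) : 0 ≤ entropy ρ := by
  rw [entropy_eq_sum hρ.1.1]
  exact div_nonneg (sum_nonneg fun i _ => Real.negMulLog_nonneg (hρ.1.eigenvalues_nonneg i)
    (eigenvalues_le_one hρ i)) (Real.log_nonneg (by norm_num))

theorem dim_pos (hρ : ρ ∈ states d) : 0 < d := by
  rcases Nat.eq_zero_or_pos d with rfl | h
  · simpa [Matrix.trace] using hρ.2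
  · exact h

theorem entropy_le (hρ : ρ ∈ states d) : entropy ρ ≤ Real.logb 2 d := by
  have hd : (0 : ℝ) < d := by exact_mod_cast dim_pos hρ
  rw [entropy_eq_sum hρ.1.1, Real.logb]
  refine div_le_div_of_nonneg_right ?_ (Real.log_nonneg (by norm_num))
  have := Real.concaveOn_negMulLog.le_map_sum (t := univ) (w := fun _ : Fin d => (d : ℝ)⁻¹)
    (p := hρ.1.1.eigenvalues) (fun _ _ => by positivity) (by simp [hd.ne'])
    (fun i _ => hρ.1.eigenvalues_nonneg i)
  simp only [smul_eq_mul, ← mul_sum, sum_eigenvalues hρ, mul_one, Real.negMulLog, Real.log_inv] at this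
  rw [inv_mul_le_iff₀ hd] at this
  simp only [Real.negMulLog]
  refine this.trans (le_of_eq ?_)
  field_simp

theorem crossEntropy_nonneg (hρ : ρ.PosSemidef) (hσ : σ ∈ states d) : 0 ≤ crossEntropy ρ σ := by
  rw [crossEntropy_eq_sum hσ.1.1, ← sum_neg_distrib]
  refine sum_nonneg fun i _ => ?_
  rw [← neg_mul]
  refine mul_nonneg ?_ (diagIn_nonneg _ hρ i)
  rw [neg_nonneg, Real.logb]
  exact div_nonpos_of_nonpos_of_nonneg (Real.log_nonpos (hσ.1.eigenvalues_nonneg i)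
    (eigenvalues_le_one hσ i)) (Real.log_nonneg (by norm_num))

/-- Measuring in an orthonormal basis does not decrease the entropy. -/
theorem entropy_le_sum_diagIn (hA : A.IsHermitian) (hρ : ρ.PosSemidef) :
    entropy ρ ≤ (∑ i, Real.negMulLog (diagIn hA ρ i)) / Real.log 2 := by
  rw [entropy_eq_sum hρ.1]
  refine div_le_div_of_nonneg_right ?_ (Real.log_nonneg (by norm_num))
  -- The squared moduli of the transition matrix are doubly stochastic: column sums split the
  -- entropy, row sums allow Jensen.
  calc ∑ j, Real.negMulLog (hρ.1.eigenvalues j)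
      = ∑ i, ∑ j, ‖transition hA hρ.1 i j‖ ^ 2 * Real.negMulLog (hρ.1.eigenvalues j) := by
        rw [sum_comm]
        simp [← sum_mul, sum_norm_sq_transition_left]
    _ ≤ _ := by
        refine sum_le_sum fun i _ => ?_
        have := Real.concaveOn_negMulLog.le_map_sum (t := univ)
          (w := fun j => ‖transition hA hρ.1 i j‖ ^ 2)
          (p := hρ.1.eigenvalues) (fun _ _ => by positivity)
          (sum_norm_sq_transition_right hA hρ.1 i) (fun i _ => hρ.eigenvalues_nonneg i)
        simp only [smul_eq_mul] at this
        simpa only [diagIn_eq_sum hA hρ.1, mul_comm] using this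

theorem posSemidef_mix (hρ : ρ.PosSemidef) (hσ : σ.PosSemidef) {a b : ℝ} (ha : 0 ≤ a)
    (hb : 0 ≤ b) : (a • ρ + b • σ).PosSemidef :=
  (hρ.smul ha).add (hσ.smul hb)

theorem entropy_concave (hρ : ρ.PosSemidef) (hσ : σ.PosSemidef) {a b : ℝ} (ha : 0 ≤ a)
    (hb : 0 ≤ b) (hab : a + b = 1) :
    a * entropy ρ + b * entropy σ ≤ entropy (a • ρ + b • σ) := by
  have hτ := posSemidef_mix hρ hσ ha hb
  have h2 : 0 < Real.log 2 := Real.log_pos (by norm_num)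
  have h1 := mul_le_mul_of_nonneg_left (entropy_le_sum_diagIn hτ.1 hρ) ha
  have h1' := mul_le_mul_of_nonneg_left (entropy_le_sum_diagIn hτ.1 hσ) hb
  refine (add_le_add h1 h1').trans ?_
  rw [entropy_eq_sum hτ.1, ← mul_div_assoc, ← mul_div_assoc, ← add_div, mul_sum, mul_sum,
    ← sum_add_distrib]
  refine div_le_div_of_nonneg_right (sum_le_sum fun i _ => ?_) h2.le
  have h3 := diagIn_self hτ.1 i
  rw [diagIn_mix] at h3
  rw [← h3]
  exact Real.concaveOn_negMulLog.2 (diagIn_nonneg hτ.1 hρ i) (diagIn_nonneg hτ.1 hσ i) ha hb hab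

/-! ### A trace form of monotonicity of the logarithm, and entropy of mixtures. -/

theorem dotProduct_mul_diagonal_mul_conjTranspose (W : Matrix (Fin d) (Fin d) ℂ) (r : Fin d → ℝ)
    (x : Fin d → ℂ) :
    (star x ⬝ᵥ ((W * Matrix.diagonal (fun j => (r j : ℂ)) * Wᴴ) *ᵥ x)).re =
      ∑ j, r j * ‖∑ i, star (x i) * W i j‖ ^ 2 := by
  have h (j : Fin d) : (Wᴴ *ᵥ x) j = star (∑ i, star (x i) * W i j) := by
    simp [Matrix.mulVec, dotProduct, mul_comm]
  rw [← Matrix.mulVec_mulVec, ← Matrix.mulVec_mulVec, Matrix.dotProduct_mulVec, dotProduct,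
    Complex.re_sum]
  refine sum_congr rfl fun j _ => ?_
  rw [Matrix.mulVec_diagonal, h j]
  change ((∑ i, star (x i) * W i j) * _).re = _
  rw [mul_left_comm, Complex.re_ofReal_mul, Complex.star_def, Complex.mul_conj, Complex.ofReal_re,
    Complex.normSq_eq_norm_sq]

/-- Operator monotonicity of the logarithm, in the form used for entropies. -/
theorem crossEntropy_le_of_le (hρ : ρ ∈ states d) (hτ : τ.PosSemidef) {c : ℝ} (hc : 0 < c)
    (h : (τ - c • ρ).PosSemidef) : crossEntropy ρ τ ≤ entropy ρ - Real.logb 2 c := by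
  set W := transition hτ.1 hρ.1.1 with hW
  set t := hτ.1.eigenvalues with ht
  set r := hρ.1.1.eigenvalues with hr
  -- The hypothesis cρ ≤ τ as an inequality of quadratic forms in the eigenbasis of τ.
  have hform : ∀ x : Fin d → ℂ, c * ∑ j, r j * ‖∑ i, star (x i) * W i j‖ ^ 2 ≤
      ∑ i, t i * ‖x i‖ ^ 2 := by
    intro x
    have h1 := (h.conjTranspose_mul_mul_same
      (hτ.1.eigenvectorUnitary : Matrix (Fin d) (Fin d) ℂ)).dotProduct_mulVec_nonneg x
    have h2 : (hτ.1.eigenvectorUnitary : Matrix (Fin d) (Fin d) ℂ)ᴴ * (τ - c • ρ) *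
        (hτ.1.eigenvectorUnitary : Matrix (Fin d) (Fin d) ℂ) = 1 * Matrix.diagonal (fun i => (t i : ℂ)) * 1ᴴ -
          c • (W * Matrix.diagonal (fun j => (r j : ℂ)) * Wᴴ) := by
      rw [mul_sub, sub_mul, conj_self_eq_diagonal, mul_smul_comm, smul_mul_assoc,
        conj_eq_transition hτ.1 hρ.1.1]
      simp [← hW, ht, hr]
    rw [h2, Matrix.sub_mulVec, Matrix.smul_mulVec, dotProduct_sub, dotProduct_smul] at h1
    have h3 := (Complex.le_def.1 h1).1
    rw [Complex.sub_re, Complex.smul_re, dotProduct_mul_diagonal_mul_conjTranspose,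
      dotProduct_mul_diagonal_mul_conjTranspose] at h3
    simpa [Matrix.one_apply] using h3
  -- Testing on a basis vector: the kernel of τ carries no weight of ρ, so the default `log 0 = 0`
  -- is harmless.
  have hker : ∀ i j, t i = 0 → r j * ‖W i j‖ ^ 2 = 0 := by
    intro i j hi
    have := hform (Pi.single i 1)
    have h1 : ∑ j, r j * ‖W i j‖ ^ 2 ≤ 0 := by
      have h2 : ∑ k, t k * ‖(Pi.single i 1 : Fin d → ℂ) k‖ ^ 2 = 0 := by
        refine sum_eq_zero fun k _ => ?_
        rcases eq_or_ne k i with rfl | hk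
        · simp [hi]
        · simp [hk]
      have h3 (j : Fin d) : ∑ k, star ((Pi.single i 1 : Fin d → ℂ) k) * W k j = W i j := by
        simp [Pi.single_apply, apply_ite]
      simp only [h2, h3] at this
      exact nonpos_of_mul_nonpos_right this hc
    have h0 : ∀ j ∈ univ, 0 ≤ r j * ‖W i j‖ ^ 2 := fun j _ =>
      mul_nonneg (hρ.1.eigenvalues_nonneg j) (by positivity)
    exact (sum_eq_zero_iff_of_nonneg h0).1 (le_antisymm h1 (sum_nonneg h0)) j (mem_univ j)
  have key : ∀ j, r j * Real.log (c * r j) ≤ r j * ∑ i, ‖W i j‖ ^ 2 * Real.log (t i) := by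
    intro j
    rcases (hρ.1.eigenvalues_nonneg j).eq_or_lt with h0 | h0
    · rw [hr, ← h0]; simp
    refine mul_le_mul_of_nonneg_left ?_ h0.le
    change 0 < r j at h0
    have hX : c * r j * ∑ i, ‖W i j‖ ^ 2 / t i ≤ 1 := by
      set X := ∑ i, ‖W i j‖ ^ 2 / t i with hXd
      have hX0 : 0 ≤ X := sum_nonneg fun i _ => div_nonneg (by positivity) (hτ.eigenvalues_nonneg i)
      -- The test vector is τ⁻¹ (pseudo-inverse, as `x / 0 = 0`) applied to the j-th eigenvector of
      -- ρ; keeping only the j-th term gives c r_j X² ≤ X.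
      have h1 := hform fun i => W i j / t i
      have h2 : ∑ i, t i * ‖W i j / t i‖ ^ 2 = X := by
        refine sum_congr rfl fun i _ => ?_
        rcases eq_or_ne (t i) 0 with hi | hi
        · simp [hi]
        · rw [norm_div, Complex.norm_real, div_pow, Real.norm_eq_abs, sq_abs]
          field_simp
      have h3 : ∑ i, star (W i j / t i) * W i j = (X : ℂ) := by
        rw [hXd, Complex.ofReal_sum]
        refine sum_congr rfl fun i _ => ?_
        rw [Complex.star_def, map_div₀, Complex.conj_ofReal, div_mul_eq_mul_div, mul_comm,
          Complex.mul_conj, Complex.normSq_eq_norm_sq, Complex.ofReal_div]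
      rw [h2] at h1
      have h4 : r j * X ^ 2 ≤ ∑ k, r k * ‖∑ i, star (W i j / t i) * W i k‖ ^ 2 := by
        refine le_trans (le_of_eq ?_) (single_le_sum (fun k _ =>
          mul_nonneg (hρ.1.eigenvalues_nonneg k) (by positivity)) (mem_univ j))
        rw [h3, Complex.norm_real, Real.norm_eq_abs, sq_abs]
      have h5 := (mul_le_mul_of_nonneg_left h4 hc.le).trans h1
      rcases hX0.eq_or_lt with hX | hX
      · simp [← hX]
      · refine le_of_mul_le_mul_right ?_ hX
        linarith
    -- Average log u ≤ u - 1 at u = c r_j / t_i with the weights |W_ij|², which sum to 1 over i.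
    have h1 : Real.log (c * r j) - ∑ i, ‖W i j‖ ^ 2 * Real.log (t i) ≤
        c * r j * ∑ i, ‖W i j‖ ^ 2 / t i - 1 := by
      rw [← sum_norm_sq_transition_left hτ.1 hρ.1.1 j, ← hW, mul_sum, ← sum_sub_distrib,
        ← one_mul (Real.log (c * r j)), ← sum_norm_sq_transition_left hτ.1 hρ.1.1 j, ← hW, sum_mul,
        ← sum_sub_distrib]
      refine sum_le_sum fun i _ => ?_
      rcases (hτ.eigenvalues_nonneg i).eq_or_lt with hi | hi
      · have := hker i j hi.symm
        rw [mul_eq_zero, or_iff_right h0.ne'] at this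
        simp [this]
      · change 0 < t i at hi
        rw [← mul_sub, ← Real.log_div (by positivity) hi.ne']
        refine (mul_le_mul_of_nonneg_left (Real.log_le_sub_one_of_pos (by positivity))
          (by positivity)).trans (le_of_eq ?_)
        ring
    linarith
  have h2 : 0 < Real.log 2 := Real.log_pos (by norm_num)
  rw [entropy_eq_sum hρ.1.1, crossEntropy_eq_sum hτ.1]
  have e1 : ∑ i, Real.logb 2 (t i) * diagIn hτ.1 ρ i =
      (∑ j, r j * ∑ i, ‖W i j‖ ^ 2 * Real.log (t i)) / Real.log 2 := by
    simp only [diagIn_eq_sum hτ.1 hρ.1.1, mul_sum, Real.logb, sum_div]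
    rw [sum_comm]
    refine sum_congr rfl fun j _ => sum_congr rfl fun i _ => ?_
    ring
  have e2 : ∑ j, r j * Real.log (c * r j) = Real.log c - ∑ j, Real.negMulLog (r j) := by
    rw [← mul_one (Real.log c), ← sum_eigenvalues hρ, mul_sum, ← sum_sub_distrib]
    refine sum_congr rfl fun j _ => ?_
    rcases (hρ.1.eigenvalues_nonneg j).eq_or_lt with h0 | h0
    · rw [hr, ← h0]; simp
    change 0 < r j at h0
    rw [Real.log_mul hc.ne' h0.ne', Real.negMulLog, ← hr]
    ring
  rw [e1, Real.logb, ← sub_div, ← neg_div]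
  refine div_le_div_of_nonneg_right ?_ h2.le
  have := sum_le_sum fun j (_ : j ∈ univ) => key j
  linarith

theorem binEntropyBits_eq (x : ℝ) : binEntropyBits x = Real.binEntropy x / Real.log 2 := by
  rw [binEntropyBits, Real.binEntropy_eq_negMulLog_add_negMulLog_one_sub, Real.negMulLog,
    Real.negMulLog, Real.logb, Real.logb]
  ring

theorem mix_mem_states (hρ : ρ ∈ states d) (hσ : σ ∈ states d) {a b : ℝ} (ha : 0 ≤ a)
    (hb : 0 ≤ b) (hab : a + b = 1) : a • ρ + b • σ ∈ states d := by
  refine ⟨posSemidef_mix hρ.1 hσ.1 ha hb, ?_⟩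
  rw [Matrix.trace_add, Matrix.trace_smul, Matrix.trace_smul, hρ.2, hσ.2, ← add_smul, hab, one_smul]

/-- The mixture dominates both aρ and bσ, so `crossEntropy_le_of_le` bounds the two parts of its
entropy separately. -/
theorem entropy_mix_le (hρ : ρ ∈ states d) (hσ : σ ∈ states d) {a b : ℝ} (ha : 0 < a)
    (hb : 0 < b) :
    entropy (a • ρ + b • σ) ≤
      a * entropy ρ + b * entropy σ - a * Real.logb 2 a - b * Real.logb 2 b := by
  have hτ := posSemidef_mix hρ.1 hσ.1 ha.le hb.le
  have h1 := crossEntropy_le_of_le hρ hτ ha (by simpa using hσ.1.smul hb.le)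
  have h2 := crossEntropy_le_of_le hσ hτ hb (by simpa using hρ.1.smul ha.le)
  rw [show entropy (a • ρ + b • σ) = crossEntropy (a • ρ + b • σ) (a • ρ + b • σ) from rfl,
    crossEntropy_mix]
  have h3 := mul_le_mul_of_nonneg_left h1 ha.le
  have h4 := mul_le_mul_of_nonneg_left h2 hb.le
  linarith

/-! ### Mixing with the maximally mixed state. -/

theorem maxMixed_eq_algebraMap :
    maxMixed d = algebraMap ℝ (Matrix (Fin d) (Fin d) ℂ) (d : ℝ)⁻¹ := by
  ext i j
  simp [maxMixed, Matrix.algebraMap_matrix_apply, Matrix.one_apply]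

theorem maxMixed_mulVec_eq_zero (hd : 0 < d) {v : Fin d → ℂ} (h : maxMixed d *ᵥ v = 0) : v = 0 := by
  rw [maxMixed, Matrix.smul_mulVec, Matrix.one_mulVec, smul_eq_zero] at h
  exact h.resolve_left (by simpa using hd.ne')

theorem crossEntropy_maxMixed (hρ : ρ ∈ states d) :
    crossEntropy ρ (maxMixed d) = Real.logb 2 d := by
  rw [crossEntropy, mlog, maxMixed_eq_algebraMap, cfc_algebraMap, Real.logb_inv,
    Algebra.algebraMap_eq_smul_one, mul_smul_comm, mul_one, Matrix.trace_smul, hρ.2]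
  simp

theorem mlog_mix_maxMixed (hω : ω.IsHermitian) (a b : ℝ) :
    mlog (a • ω + b • maxMixed d) = cfc (fun x => Real.logb 2 (a * x + b * (d : ℝ)⁻¹)) ω := by
  have hω' : IsSelfAdjoint ω := hω
  have hfin := Matrix.finite_real_spectrum (A := ω)
  have h : a • ω + b • maxMixed d = cfc (fun x => a * x + b * (d : ℝ)⁻¹) ω := by
    rw [cfc_add_const (b * (d : ℝ)⁻¹) (fun x => a * x) ω, cfc_const_mul_id a ω, maxMixed_eq_algebraMap, map_mul,
      Algebra.algebraMap_eq_smul_one b, smul_one_mul]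
  rw [h, mlog, ← cfc_comp' (Real.logb 2) (fun x => a * x + b * (d : ℝ)⁻¹) ω
    ((hfin.image _).continuousOn _)]

/-- In the eigenbasis of ω each eigenvalue of the mixture is at least a times that of ω. Where ω has
eigenvalue 0 the default value of the logarithm would break the comparison, but there the support
condition kills the weight of ρ. -/
theorem crossEntropy_mix_maxMixed_le_of_support (hρ : ρ ∈ states d) (hω : ω ∈ states d)
    (h : ∀ v : Fin d → ℂ, ω *ᵥ v = 0 → ρ *ᵥ v = 0) {a b : ℝ} (ha : 0 < a) (hb : 0 ≤ b) :
    crossEntropy ρ (a • ω + b • maxMixed d) ≤ crossEntropy ρ ω - Real.logb 2 a := by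
  rw [crossEntropy_eq_sum hω.1.1, crossEntropy, mlog_mix_maxMixed hω.1.1, trace_mul_cfc hω.1.1]
  have h1 : Real.logb 2 a = ∑ i, Real.logb 2 a * diagIn hω.1.1 ρ i := by
    rw [← mul_sum, sum_diagIn, hρ.2]
    simp
  rw [h1, ← neg_add', ← sum_add_distrib, neg_le_neg_iff]
  refine sum_le_sum fun i _ => ?_
  rw [← add_mul]
  rcases (hω.1.eigenvalues_nonneg i).eq_or_lt with hi | hi
  · have h2 : ρ *ᵥ ⇑(hω.1.1.eigenvectorBasis i) = 0 := by
      apply h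
      rw [hω.1.1.mulVec_eigenvectorBasis, ← hi, zero_smul]
    have h3 : diagIn hω.1.1 ρ i = 0 := by
      have h4 : ((hω.1.1.eigenvectorUnitary : Matrix (Fin d) (Fin d) ℂ)ᴴ * ρ *
          hω.1.1.eigenvectorUnitary).col i = 0 := by
        rw [← Matrix.mulVec_single_one, ← Matrix.mulVec_mulVec,
          Matrix.IsHermitian.eigenvectorUnitary_mulVec, ← Matrix.mulVec_mulVec, h2,
          Matrix.mulVec_zero]
      have h5 := congrFun h4 i
      rw [Matrix.col_apply] at h5
      rw [diagIn, h5]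
      simp
    simp [h3]
  · refine mul_le_mul_of_nonneg_right ?_ (diagIn_nonneg _ hρ.1 i)
    rw [add_comm, ← Real.logb_mul ha.ne' hi.ne']
    refine Real.logb_le_logb_of_le (by norm_num) (by positivity) ?_
    exact le_add_of_nonneg_right (by positivity)

theorem crossEntropy_mix_maxMixed_le (hσ : σ ∈ states d) (hω : ω ∈ states d) {a b : ℝ}
    (ha : 0 ≤ a) (hb : 0 < b) :
    crossEntropy σ (a • ω + b • maxMixed d) ≤ Real.logb 2 d - Real.logb 2 b := by
  have hd : (0 : ℝ) < d := by exact_mod_cast dim_pos hσ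
  rw [crossEntropy, mlog_mix_maxMixed hω.1.1, trace_mul_cfc hω.1.1]
  have h1 : Real.logb 2 d - Real.logb 2 b =
      -∑ i, Real.logb 2 (b * (d : ℝ)⁻¹) * diagIn hω.1.1 σ i := by
    rw [← mul_sum, sum_diagIn, hσ.2, Real.logb_mul hb.ne' (by positivity), Real.logb_inv]
    simp
    ring
  rw [h1, neg_le_neg_iff]
  refine sum_le_sum fun i _ => mul_le_mul_of_nonneg_right ?_ (diagIn_nonneg _ hσ.1 i)
  refine Real.logb_le_logb_of_le (by norm_num) (by positivity) ?_
  exact le_add_of_nonneg_left (mul_nonneg ha (hω.1.eigenvalues_nonneg i))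

theorem mulVec_eq_zero_of_mix (hρ : ρ.PosSemidef) (hσ : σ.PosSemidef) {a b : ℝ} (ha : 0 < a)
    (hb : 0 ≤ b) {v : Fin d → ℂ} (h : (a • ρ + b • σ) *ᵥ v = 0) : ρ *ᵥ v = 0 := by
  rw [← hρ.dotProduct_mulVec_zero_iff]
  have h1 := congrArg (star v ⬝ᵥ ·) h
  simp only [Matrix.add_mulVec, Matrix.smul_mulVec, dotProduct_add, dotProduct_smul,
    dotProduct_zero] at h1
  have h2 := smul_nonneg ha.le (hρ.dotProduct_mulVec_nonneg v)
  have h3 := smul_nonneg hb (hσ.dotProduct_mulVec_nonneg v)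
  have h4 := ((add_eq_zero_iff_of_nonneg h2 h3).1 h1).1
  exact (smul_eq_zero.1 h4).resolve_left ha.ne'

/-! ### The infimum: finiteness and crude bounds. -/

theorem relEntropy_of_support (h : ∀ v : Fin d → ℂ, σ *ᵥ v = 0 → ρ *ᵥ v = 0) :
    relEntropy ρ σ = ((crossEntropy ρ σ - entropy ρ : ℝ) : EReal) := by
  rw [relEntropy, if_pos h, crossEntropy, entropy, neg_sub_neg]

theorem le_relEntDist (x : ℝ)
    (h : ∀ ω ∈ D, (∀ v : Fin d → ℂ, ω *ᵥ v = 0 → ρ *ᵥ v = 0) →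
      x ≤ crossEntropy ρ ω - entropy ρ) : (x : EReal) ≤ relEntDist D ρ := by
  refine le_iInf₂ fun ω hω => ?_
  by_cases hs : ∀ v : Fin d → ℂ, ω *ᵥ v = 0 → ρ *ᵥ v = 0
  · rw [relEntropy_of_support hs]
    exact_mod_cast h ω hω hs
  · rw [relEntropy, if_neg hs]
    exact le_top

theorem relEntDist_le (hω : ω ∈ D) (h : ∀ v : Fin d → ℂ, ω *ᵥ v = 0 → ρ *ᵥ v = 0) :
    relEntDist D ρ ≤ ((crossEntropy ρ ω - entropy ρ : ℝ) : EReal) :=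
  (iInf₂_le ω hω).trans (relEntropy_of_support h).le

/-- Nonnegativity of relative entropy is not needed: this cruder bound already fits the 2ε log d
budget. -/
theorem neg_logb_le_relEntDist (hD : D ⊆ states d) (hρ : ρ ∈ states d) :
    ((-Real.logb 2 d : ℝ) : EReal) ≤ relEntDist D ρ :=
  le_relEntDist _ fun ω hω _ => by
    linarith [crossEntropy_nonneg hρ.1 (hD hω), entropy_le hρ]

theorem relEntDist_le_logb (hmixed : maxMixed d ∈ D) (hρ : ρ ∈ states d) :
    relEntDist D ρ ≤ ((Real.logb 2 d : ℝ) : EReal) := by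
  refine (relEntDist_le hmixed fun v hv => ?_).trans ?_
  · rw [maxMixed_mulVec_eq_zero (dim_pos hρ) hv, Matrix.mulVec_zero]
  · rw [crossEntropy_maxMixed hρ]
    exact_mod_cast sub_le_self _ (entropy_nonneg hρ)

theorem relEntDist_ne_bot (hD : D ⊆ states d) (hρ : ρ ∈ states d) : relEntDist D ρ ≠ ⊥ :=
  ((EReal.bot_lt_coe _).trans_le (neg_logb_le_relEntDist hD hρ)).ne'

theorem relEntDist_ne_top (hmixed : maxMixed d ∈ D) (hρ : ρ ∈ states d) : relEntDist D ρ ≠ ⊤ :=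
  ((relEntDist_le_logb hmixed hρ).trans_lt (EReal.coe_lt_top _)).ne

theorem coe_toReal_relEntDist (hD : D ⊆ states d) (hmixed : maxMixed d ∈ D) (hρ : ρ ∈ states d) :
    ((relEntDist D ρ).toReal : EReal) = relEntDist D ρ :=
  EReal.coe_toReal (relEntDist_ne_top hmixed hρ) (relEntDist_ne_bot hD hρ)

theorem abs_toReal_relEntDist_le (hD : D ⊆ states d) (hmixed : maxMixed d ∈ D)
    (hρ : ρ ∈ states d) : |(relEntDist D ρ).toReal| ≤ Real.logb 2 d := by
  have h1 := neg_logb_le_relEntDist hD hρ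
  have h2 := relEntDist_le_logb hmixed hρ
  rw [← coe_toReal_relEntDist hD hmixed hρ, EReal.coe_le_coe_iff] at h1 h2
  exact abs_le.2 ⟨h1, h2⟩

/-! ### Robustness under admixtures. -/

theorem toReal_relEntDist_mix_le (hD : D ⊆ states d) (hconv : Convex ℝ D)
    (hmixed : maxMixed d ∈ D) (hρ : ρ ∈ states d) (hσ : σ ∈ states d) (h0 : 0 < ε) (h1 : ε < 1) :
    (relEntDist D ((1 - ε) • ρ + ε • σ)).toReal ≤
      (1 - ε) * (relEntDist D ρ).toReal + ε * Real.logb 2 d + binEntropyBits ε := by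
  have h1' : 0 < 1 - ε := by linarith
  have hτ := mix_mem_states hρ hσ h1'.le h0.le (by ring)
  -- Solved for E(ρ), the claim becomes a lower bound on an infimum, to be checked for each
  -- competitor ω; this needs ε < 1.
  have key : (((relEntDist D ((1 - ε) • ρ + ε • σ)).toReal - ε * Real.logb 2 d -
      binEntropyBits ε) / (1 - ε) : ℝ) ≤ relEntDist D ρ := by
    refine le_relEntDist _ fun ω hω hs => ?_
    have hω' : (1 - ε) • ω + ε • maxMixed d ∈ D := hconv hω hmixed h1'.le h0.le (by ring)
    have h2 := relEntDist_le (ρ := (1 - ε) • ρ + ε • σ) hω' fun v hv => by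
      rw [add_comm] at hv
      rw [maxMixed_mulVec_eq_zero (dim_pos hρ) (mulVec_eq_zero_of_mix (hD hmixed).1 (hD hω).1
        h0 h1'.le hv), Matrix.mulVec_zero]
    rw [← coe_toReal_relEntDist hD hmixed hτ, EReal.coe_le_coe_iff, crossEntropy_mix] at h2
    have h3 := entropy_concave hρ.1 hσ.1 h1'.le h0.le (by ring)
    have h4 := mul_le_mul_of_nonneg_left
      (crossEntropy_mix_maxMixed_le_of_support hρ (hD hω) hs h1' h0.le) h1'.le
    have h5 := mul_le_mul_of_nonneg_left
      (crossEntropy_mix_maxMixed_le hσ (hD hω) h1'.le h0) h0.le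
    have h6 := mul_nonneg h0.le (entropy_nonneg hσ)
    rw [div_le_iff₀' h1', binEntropyBits]
    linarith
  rw [← coe_toReal_relEntDist hD hmixed hρ, EReal.coe_le_coe_iff, div_le_iff₀' h1'] at key
  linarith

theorem mul_toReal_relEntDist_le (hD : D ⊆ states d)
    (hmixed : maxMixed d ∈ D) (hρ : ρ ∈ states d) (hσ : σ ∈ states d) (h0 : 0 < ε) (h1 : ε < 1) :
    (1 - ε) * (relEntDist D ρ).toReal ≤
      (relEntDist D ((1 - ε) • ρ + ε • σ)).toReal + ε * Real.logb 2 d + binEntropyBits ε := by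
  have h1' : 0 < 1 - ε := by linarith
  have hτ := mix_mem_states hρ hσ h1'.le h0.le (by ring)
  have key : (((1 - ε) * (relEntDist D ρ).toReal - ε * Real.logb 2 d -
      binEntropyBits ε : ℝ) : EReal) ≤ relEntDist D ((1 - ε) • ρ + ε • σ) := by
    refine le_relEntDist _ fun ω hω hs => ?_
    have h2 := relEntDist_le (ρ := ρ) hω fun v hv =>
      mulVec_eq_zero_of_mix hρ.1 hσ.1 h1' h0.le (hs v hv)
    rw [← coe_toReal_relEntDist hD hmixed hρ, EReal.coe_le_coe_iff] at h2
    have h3 := entropy_mix_le hρ hσ h1' h0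
    have h4 := mul_le_mul_of_nonneg_left h2 h1'.le
    have h5 := mul_nonneg h0.le (crossEntropy_nonneg hσ.1 (hD hω))
    have h6 := mul_le_mul_of_nonneg_left (entropy_le hσ) h0.le
    rw [crossEntropy_mix, binEntropyBits]
    linarith
  rw [← coe_toReal_relEntDist hD hmixed hτ, EReal.coe_le_coe_iff] at key
  linarith

/-- Robustness of the relative entropy distance under admixtures. -/
theorem abs_relEntDist_mix_sub_le (hD : D ⊆ states d) (hconv : Convex ℝ D)
    (hmixed : maxMixed d ∈ D) (hρ : ρ ∈ states d) (hσ : σ ∈ states d) (h0 : 0 ≤ ε) (h1 : ε ≤ 1) :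
    |(relEntDist D ((1 - ε) • ρ + ε • σ)).toReal - (relEntDist D ρ).toReal| ≤
      2 * ε * Real.logb 2 d + binEntropyBits ε := by
  have hE := abs_le.1 (abs_toReal_relEntDist_le hD hmixed hρ)
  have hE' := abs_le.1 (abs_toReal_relEntDist_le hD hmixed hσ)
  rcases h0.eq_or_lt with rfl | h0
  · simp [binEntropyBits]
  rcases h1.eq_or_lt with rfl | h1
  -- At ε = 1 the mixture is σ, and |E| ≤ log d for both states suffices.
  · rw [binEntropyBits_eq, Real.binEntropy_one, sub_self, zero_smul, one_smul, zero_add, zero_div, abs_le]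
    constructor <;> linarith [hE.1, hE.2, hE'.1, hE'.2]
  have h2 := toReal_relEntDist_mix_le hD hconv hmixed hρ hσ h0 h1
  have h3 := mul_toReal_relEntDist_le hD hmixed hρ hσ h0 h1
  have h4 := mul_le_mul_of_nonneg_left hE.1 h0.le
  have h5 := mul_le_mul_of_nonneg_left hE.2 h0.le
  rw [abs_le]
  constructor <;> linarith

/-! ### Trace norm and Jordan decomposition. -/

theorem trace_cfc (hA : A.IsHermitian) (f : ℝ → ℝ) :
    (cfc f A).trace = ((∑ i, f (hA.eigenvalues i) : ℝ) : ℂ) := by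
  rw [cfc_eq_mul_diagonal_mul hA, Matrix.trace_mul_comm, ← mul_assoc,
    conjTranspose_mul_eigenvectorUnitary, one_mul, Matrix.trace_diagonal, Complex.ofReal_sum]

theorem posSemidef_cfc (hA : A.IsHermitian) {f : ℝ → ℝ} (hf : ∀ x, 0 ≤ f x) :
    (cfc f A).PosSemidef := by
  rw [cfc_eq_mul_diagonal_mul hA]
  refine Matrix.PosSemidef.mul_mul_conjTranspose_same (Matrix.PosSemidef.diagonal fun i => ?_) _
  exact Complex.zero_le_real.2 (hf _)

theorem traceNorm_eq_sum (hA : A.IsHermitian) : traceNorm A = ∑ i, |hA.eigenvalues i| := by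
  have hA' : IsSelfAdjoint A := hA
  have h : A * Aᴴ = cfc (fun x : ℝ => x * x) A := by
    rw [cfc_mul .., cfc_id' ℝ A, hA.eq]
  rw [traceNorm, h, ← cfc_comp' Real.sqrt (fun x : ℝ => x * x) A, trace_cfc hA, Complex.ofReal_re]
  exact sum_congr rfl fun i _ => Real.sqrt_mul_self_eq_abs _

/-- The Jordan decomposition of a traceless Hermitian matrix. -/
theorem exists_jordan_decomposition (hA : A.IsHermitian) (htr : A.trace = 0) :
    ∃ P N : Matrix (Fin d) (Fin d) ℂ, P.PosSemidef ∧ N.PosSemidef ∧ A = P - N ∧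
      P.trace = ((traceNorm A / 2 : ℝ) : ℂ) ∧ N.trace = ((traceNorm A / 2 : ℝ) : ℂ) := by
  have hA' : IsSelfAdjoint A := hA
  have hP : (cfc (fun x : ℝ => max x 0) A).trace = _ := trace_cfc hA _
  have hN : (cfc (fun x : ℝ => max (-x) 0) A).trace = _ := trace_cfc hA _
  have hsub : A = cfc (fun x : ℝ => max x 0) A - cfc (fun x : ℝ => max (-x) 0) A := by
    rw [← cfc_sub ..]
    conv_lhs => rw [← cfc_id' ℝ A]
    congr 1
    ext x
    rcases le_total x 0 with h | h <;> simp [h]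
  have h1 : ∑ i, max (hA.eigenvalues i) 0 - ∑ i, max (-hA.eigenvalues i) 0 = 0 := by
    have := congrArg Matrix.trace hsub
    rw [htr, Matrix.trace_sub, hP, hN] at this
    exact_mod_cast this.symm
  have h2 : ∑ i, max (hA.eigenvalues i) 0 + ∑ i, max (-hA.eigenvalues i) 0 = traceNorm A := by
    rw [traceNorm_eq_sum hA, ← sum_add_distrib]
    refine sum_congr rfl fun i _ => ?_
    rcases le_total (hA.eigenvalues i) 0 with h | h <;> simp [h, abs_of_nonneg, abs_of_nonpos]
  refine ⟨_, _, posSemidef_cfc hA fun x => le_max_right _ _,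
    posSemidef_cfc hA fun x => le_max_right _ _, hsub, hP.trans ?_, hN.trans ?_⟩ <;>
  · congr 1
    linarith

/-! ### Asymptotic continuity. -/

theorem concaveOn_two_mul_add_binEntropyBits :
    ConcaveOn ℝ (Set.Icc 0 1) fun x => 2 * x + binEntropyBits x := by
  have h1 : ConcaveOn ℝ (Set.Icc (0 : ℝ) 1) fun x : ℝ => 2 * x :=
    ((LinearMap.mulLeft ℝ (2 : ℝ)).concaveOn (convex_Icc 0 1))
  have h2 := Real.strictConcave_binEntropy.concaveOn.smul
    (inv_nonneg.2 (Real.log_nonneg (by norm_num : (1 : ℝ) ≤ 2)))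
  refine (h1.add h2).congr fun x _ => ?_
  simp [binEntropyBits_eq, div_eq_inv_mul]

theorem binEntropyBits_le_one (x : ℝ) : binEntropyBits x ≤ 1 := by
  rw [binEntropyBits_eq]
  exact div_le_one_of_le₀ Real.binEntropy_le_log_two (Real.log_nonneg (by norm_num))

theorem binEntropyBits_nonneg {x : ℝ} (h0 : 0 ≤ x) (h1 : x ≤ 1) : 0 ≤ binEntropyBits x := by
  rw [binEntropyBits_eq]
  exact div_nonneg (Real.binEntropy_nonneg h0 h1) (Real.log_nonneg (by norm_num))

/-- H alone is not monotone on [0,1]. With 2x added, the value at x ≤ 1/2 is at most 2, the value at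
1, and concavity keeps the function above the smaller endpoint value on [x,1]. -/
theorem two_mul_add_binEntropyBits_le {x y : ℝ} (h0 : 0 ≤ x) (hx : x ≤ 1 / 2) (hxy : x ≤ y)
    (hy : y ≤ 1) : 2 * x + binEntropyBits x ≤ 2 * y + binEntropyBits y := by
  have h2 : 2 * x + binEntropyBits x ≤ 2 * 1 + binEntropyBits 1 := by
    have : binEntropyBits 1 = 0 := by simp [binEntropyBits]
    linarith [binEntropyBits_le_one x]
  have h3 := concaveOn_two_mul_add_binEntropyBits.min_le_of_mem_Icc
    (Set.mem_Icc.2 ⟨h0, by linarith⟩) (Set.mem_Icc.2 ⟨zero_le_one, le_rfl⟩) (Set.mem_Icc.2 ⟨hxy, hy⟩)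
  rwa [min_eq_left h2] at h3

/-- Asymptotic continuity of the relative entropy distance. -/
theorem abs_relEntDist_sub_le (hD : D ⊆ states d) (hconv : Convex ℝ D)
    (hmixed : maxMixed d ∈ D) (hρ : ρ ∈ states d) (hσ : σ ∈ states d)
    (h1 : traceNorm (ρ - σ) ≤ 1) :
    |(relEntDist D ρ).toReal - (relEntDist D σ).toReal| ≤
      4 * traceNorm (ρ - σ) * Real.logb 2 d + 2 * binEntropyBits (traceNorm (ρ - σ)) := by
  set δ := traceNorm (ρ - σ) with hδ
  have hherm : (ρ - σ).IsHermitian := hρ.1.1.sub hσ.1.1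
  have h0 : 0 ≤ δ := by
    rw [hδ, traceNorm_eq_sum hherm]
    exact sum_nonneg fun i _ => abs_nonneg _
  obtain ⟨P, N, hP, hN, hPN, htP, htN⟩ := exists_jordan_decomposition hherm
    (by rw [Matrix.trace_sub, hρ.2, hσ.2, sub_self])
  rw [← hδ] at htP htN
  rcases h0.eq_or_lt with h0 | h0
  · rw [← h0, zero_div, Complex.ofReal_zero] at htP htN
    rw [hP.trace_eq_zero_iff.1 htP, hN.trace_eq_zero_iff.1 htN, sub_zero, sub_eq_zero] at hPN
    rw [hPN, sub_self, abs_zero, ← h0]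
    simp [binEntropyBits]
  have hnorm : ∀ {M : Matrix (Fin d) (Fin d) ℂ}, M.PosSemidef → M.trace = ((δ / 2 : ℝ) : ℂ) →
      (δ / 2)⁻¹ • M ∈ states d := fun hM htM =>
    ⟨hM.smul (by positivity), by
      rw [Matrix.trace_smul, htM, Complex.real_smul, ← Complex.ofReal_mul,
        inv_mul_cancel₀ (by positivity), Complex.ofReal_one]⟩
  -- Chosen so that x · (2/δ) = 1 - x: both mixtures below are then 1 - x times ρ + N = σ + P.
  set x := δ / (2 + δ) with hx
  have hx0 : 0 ≤ x := by positivity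
  have hx2 : x ≤ 1 / 2 := by
    rw [hx, div_le_div_iff₀ (by positivity) (by positivity)]
    linarith
  have hxδ : x ≤ δ := div_le_self h0.le (by linarith)
  have hxc : x * (δ / 2)⁻¹ = 1 - x := by
    rw [hx]
    field_simp
    ring
  have hτ : (1 - x) • ρ + x • ((δ / 2)⁻¹ • N) = (1 - x) • σ + x • ((δ / 2)⁻¹ • P) := by
    rw [smul_smul, smul_smul, hxc, ← smul_add, ← smul_add]
    congr 1
    rw [← sub_eq_zero]
    rw [← sub_eq_zero] at hPN
    rw [← hPN]
    abel
  have e1 := abs_relEntDist_mix_sub_le hD hconv hmixed hρ (hnorm hN htN) hx0 (by linarith)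
  have e2 := abs_relEntDist_mix_sub_le hD hconv hmixed hσ (hnorm hP htP) hx0 (by linarith)
  rw [hτ, abs_sub_comm] at e1
  have e3 := (abs_sub_le _ _ _).trans (add_le_add e1 e2)
  -- For d ≥ 2, log d ≥ 1, so 4(δ - x) log d ≥ 4(δ - x) pays for a possible drop from 2H(x) to
  -- 2H(δ). For d = 1 both distances vanish.
  rcases (Nat.succ_le_of_lt (dim_pos hρ)).eq_or_lt with hd | hd
  · have hl : Real.logb 2 d = 0 := by simp [← hd]
    have b1 := abs_toReal_relEntDist_le hD hmixed hρ
    have b2 := abs_toReal_relEntDist_le hD hmixed hσ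
    rw [hl, abs_nonpos_iff] at b1 b2
    rw [b1, b2, hl]
    simpa using binEntropyBits_nonneg h0.le h1
  · have hl : 1 ≤ Real.logb 2 d := by
      rw [Real.le_logb_iff_rpow_le (by norm_num) (by positivity), Real.rpow_one]
      exact_mod_cast hd
    have h2 := two_mul_add_binEntropyBits_le hx0 hx2 hxδ h1
    have h3 := mul_le_mul_of_nonneg_left hl (sub_nonneg.2 hxδ)
    linarith

end RelEntDist

end

theorem lemma2 (d : ℕ) (D : Set (Matrix (Fin d) (Fin d) ℂ))
    (hD : D ⊆ RelEntDist.states d) (hconv : Convex ℝ D) (hmixed : RelEntDist.maxMixed d ∈ D) :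
    (∀ ρ ∈ RelEntDist.states d,
      RelEntDist.relEntDist D ρ ≠ ⊥ ∧ RelEntDist.relEntDist D ρ ≠ ⊤) ∧
    (∀ ρ ∈ RelEntDist.states d, ∀ σ ∈ RelEntDist.states d, ∀ ε : ℝ, 0 ≤ ε → ε ≤ 1 →
      |(RelEntDist.relEntDist D ((1 - ε) • ρ + ε • σ)).toReal
          - (RelEntDist.relEntDist D ρ).toReal|
        ≤ 2 * ε * Real.logb 2 d + RelEntDist.binEntropyBits ε) ∧
    (∀ ρ ∈ RelEntDist.states d, ∀ σ ∈ RelEntDist.states d, ∀ ε : ℝ,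
      ε = RelEntDist.traceNorm (ρ - σ) → ε ≤ 1 →
      |(RelEntDist.relEntDist D ρ).toReal - (RelEntDist.relEntDist D σ).toReal|
        ≤ 4 * ε * Real.logb 2 d + 2 * RelEntDist.binEntropyBits ε) := by
  refine ⟨fun ρ hρ => ⟨RelEntDist.relEntDist_ne_bot hD hρ, RelEntDist.relEntDist_ne_top hmixed hρ⟩,
    fun ρ hρ σ hσ ε h0 h1 => RelEntDist.abs_relEntDist_mix_sub_le hD hconv hmixed hρ hσ h0 h1, ?_⟩
  rintro ρ hρ σ hσ ε rfl h1
  exact RelEntDist.abs_relEntDist_sub_le hD hconv hmixed hρ hσ h1
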